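/- Let $\mathsf T$ be an essentially small triangulated category with suspension $\Sigma$. Call $\mathsf T$ *locally noetherian* if every cohomological functor $\mathsf T^{\mathrm{op}}\to\mathsf{Ab}$ (an additive functor sending exact triangles to exact sequences) is a direct sum of representable functors $\operatorname{Hom}_{\mathsf T}(-,X_i)$, and *locally finite* if both $\mathsf T$ and $\mathsf T^{\mathrm{op}}$ are locally noetherian. A morphism $\beta\colon Y\to Z$ is *right almost split* if it is not a retraction and every morphism $Y'\to Z$ that is not a retraction factors through $\beta$; *left almost split* morphisms are defined dually. An exact triangle $X\xrightarrow{\alpha}Y\xrightarrow{\beta}Z\xrightarrow{\gamma}\Sigma X$ is an *Auslander–Reiten triangle* starting at $X$ and ending at $Z$ if $\alpha$ is left almost split and $\beta$ is right almost split. 1. If $\mathsf T$ is locally noetherian, then for every indecomposable object $Z$ of $\mathsf T$ there exists an Auslander–Reiten triangle ending at $Z$. 2. If $\mathsf T$ is locally finite, then for every indecomposable object $X$ of $\mathsf T$ there exist an Auslander–Reiten triangle starting at $X$ and an Auslander–Reiten triangle ending at $X$. -/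

import Mathlib

universe v u

open CategoryTheory CategoryTheory.Limits

namespace ARTriangles

section AlmostSplit

variable {C : Type u} [Category.{v} C]

/-- A morphism `f : X ⟶ Y` is right almost split if it is not a retraction and every morphism
`X' ⟶ Y` that is not a retraction factors through `f`. -/
def IsRightAlmostSplit {X Y : C} (f : X ⟶ Y) : Prop :=
  ¬ IsSplitEpi f ∧ ∀ ⦃X' : C⦄ (g : X' ⟶ Y), ¬ IsSplitEpi g → ∃ h : X' ⟶ X, h ≫ f = g

/-- A morphism `f : X ⟶ Y` is left almost split if it is not a section and every morphism
`X ⟶ Y'` that is not a section factors through `f`. -/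
def IsLeftAlmostSplit {X Y : C} (f : X ⟶ Y) : Prop :=
  ¬ IsSplitMono f ∧ ∀ ⦃Y' : C⦄ (g : X ⟶ Y'), ¬ IsSplitMono g → ∃ h : Y ⟶ Y', f ≫ h = g

end AlmostSplit

section Representable

variable {C : Type u} [Category.{v} C] [Preadditive C]

/-- A functor `F : Cᵒᵖ ⥤ Ab` is a direct sum of representable functors if
`F ≅ ⨁ i, Hom(-, X i)` for some (small) family of objects `X i` of `C`. -/
def IsDirectSumOfRepresentables (F : Cᵒᵖ ⥤ AddCommGrpCat.{v}) : Prop :=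
  ∃ (ι : Type v) (X : ι → C), Nonempty (F ≅ ∐ fun i => preadditiveYoneda.obj (X i))

end Representable

section Triangulated

variable (C : Type u) [Category.{v} C] [HasZeroObject C] [HasShift C ℤ] [Preadditive C]
  [∀ n : ℤ, (shiftFunctor C n).Additive] [Pretriangulated C]

open scoped Pretriangulated.Opposite in
/-- An (essentially small) triangulated category is locally noetherian if every cohomological
functor `Cᵒᵖ ⥤ Ab` is a direct sum of representable functors. Here the functor `F` is
cohomological if it is additive and sends exact triangles of `C` to exact sequences; this is
expressed as `F` being homological for the triangulated structure on `Cᵒᵖ`. -/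
def LocallyNoetherian : Prop :=
  ∀ F : Cᵒᵖ ⥤ AddCommGrpCat.{v}, F.IsHomological → IsDirectSumOfRepresentables F

open scoped Pretriangulated.Opposite in
/-- An (essentially small) triangulated category is locally finite if it and its opposite
are locally noetherian. -/
def LocallyFinite : Prop :=
  LocallyNoetherian C ∧ LocallyNoetherian Cᵒᵖ

variable {C}

/-- An exact triangle `X ⟶ Y ⟶ Z ⟶ X⟦1⟧` is an Auslander–Reiten triangle (starting at `X`
and ending at `Z`) if its first morphism is left almost split and its second morphism is right
almost split. -/
def IsAuslanderReitenTriangle (T : Pretriangulated.Triangle C) : Prop :=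
  T ∈ Pretriangulated.distinguishedTriangles ∧ IsLeftAlmostSplit T.mor₁ ∧ IsRightAlmostSplit T.mor₂

/-- There is an Auslander–Reiten triangle ending at `Z`. -/
def ExistsARTriangleEndingAt (Z : C) : Prop :=
  ∃ (X Y : C) (α : X ⟶ Y) (β : Y ⟶ Z) (γ : Z ⟶ (shiftFunctor C (1 : ℤ)).obj X),
    IsAuslanderReitenTriangle (Pretriangulated.Triangle.mk α β γ)

/-- There is an Auslander–Reiten triangle starting at `X`. -/
def ExistsARTriangleStartingAt (X : C) : Prop :=
  ∃ (Y Z : C) (α : X ⟶ Y) (β : Y ⟶ Z) (γ : Z ⟶ (shiftFunctor C (1 : ℤ)).obj X),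
    IsAuslanderReitenTriangle (Pretriangulated.Triangle.mk α β γ)

end Triangulated

end ARTriangles

namespace ARTriangles

open Opposite Pretriangulated

/-! ### Direct sums of representable functors -/

section Compactness

variable {C : Type u} [Category.{v} C] [Preadditive C]

/-! Fix an indecomposable `Z`. By Fitting's lemma its non-isomorphisms form a proper subgroup of
`End Z`, so some nonzero `x : End Z ⟶ J` with `J` injective kills them. The functor `W ↦ Hom(Hom(Z,
W), J)` is cohomological, hence a sum of representables, and the map from `Hom(-, Z)` given by `x`
factors through a representable summand. This yields a nonzero `γ : Z ⟶ X` killed by every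
non-retraction into `Z`, and `X` can be cut down to an indecomposable summand. If `γ ≫ f ≠ 0`,
injectivity of `J` extends `x` along `γ ≫ f`, which gives `w` with `γ ≫ f ≫ w = γ`; by Fitting `f ≫
w` is invertible, so `f` is a section. Completing `γ` to a triangle gives an Auslander–Reiten
triangle.

Fitting's lemma and the indecomposable summand both come from Bass' argument
(`LocallyNoetherian.exists_cocone`): the colimit of a sequence of representables is cohomological,
hence a sum of representables, and this forces the sequence to stabilise up to a summand. Triangles
starting at an object come from the opposite category. -/

/-- The natural transformation `Hom(-, X) ⟶ F` attached to an element of `F(X)`. -/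
def yonedaLift (F : Cᵒᵖ ⥤ AddCommGrpCat.{v}) [F.Additive] {X : C} (y : F.obj (op X)) :
    preadditiveYoneda.obj X ⟶ F where
  app W := AddCommGrpCat.ofHom
    { toFun := fun g : W.unop ⟶ X => F.map g.op y
      map_zero' := by
        change F.map (0 : op X ⟶ W) y = 0
        rw [F.map_zero]; rfl
      map_add' := fun g h => by
        change F.map (g.op + h.op) y = _
        rw [F.map_add]; rfl }
  naturality W W' f := by
    ext (g : W.unop ⟶ X)
    change F.map (f.unop ≫ g).op y = F.map f (F.map g.op y)
    simp

lemma natTrans_app_eq {F : Cᵒᵖ ⥤ AddCommGrpCat.{v}} {X W : C} (φ : preadditiveYoneda.obj X ⟶ F)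
    (g : W ⟶ X) : φ.app (op W) g = F.map g.op (φ.app (op X) (𝟙 X)) := by
  have h := ConcreteCategory.congr_hom (φ.naturality g.op) (𝟙 X)
  change φ.app (op W) (g ≫ 𝟙 X) = _ at h
  rwa [Category.comp_id] at h

lemma natTrans_ext {F : Cᵒᵖ ⥤ AddCommGrpCat.{v}} {X : C} {φ ψ : preadditiveYoneda.obj X ⟶ F}
    (h : φ.app (op X) (𝟙 X) = ψ.app (op X) (𝟙 X)) : φ = ψ := by
  ext W (g : W.unop ⟶ X)
  exact (natTrans_app_eq φ g).trans (by rw [h]; exact (natTrans_app_eq ψ g).symm)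

instance : (preadditiveYoneda : C ⥤ Cᵒᵖ ⥤ AddCommGrpCat.{v}).Additive where
  map_add := natTrans_ext (Preadditive.comp_add _ _ _ _ _ _)

/-- The restriction of a coproduct to the summands indexed by a finite set. -/
noncomputable def truncation {D : Type*} [Category D] [HasZeroMorphisms D] {ι : Type*} (G : ι → D)
    [HasCoproduct G] (S : Finset ι) : ∐ G ⟶ ∐ G := by
  classical exact Sigma.desc fun i => if i ∈ S then Sigma.ι G i else 0

-- Elements of a direct sum have finite support. The coproduct is only known by its universal
-- property, so the supported elements are collected in a subgroup `K` and the quotient by `K` is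
-- shown to vanish on each summand.
omit [Preadditive C] in
lemma truncation_eventually_eq {ι : Type v} (G : ι → Cᵒᵖ ⥤ AddCommGrpCat.{v}) (Y : Cᵒᵖ)
    (z : (∐ G).obj Y) :
    ∃ S₀ : Finset ι, ∀ S, S₀ ⊆ S → (truncation G S).app Y z = z := by
  classical
  let K : AddSubgroup ((∐ G).obj Y) :=
    { carrier := {z | ∃ S₀ : Finset ι, ∀ S, S₀ ⊆ S → (truncation G S).app Y z = z}
      zero_mem' := ⟨∅, fun S _ => map_zero _⟩
      add_mem' := by
        rintro a b ⟨S, hS⟩ ⟨S', hS'⟩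
        refine ⟨S ∪ S', fun U hU => ?_⟩
        rw [map_add, hS U (Finset.union_subset_left hU), hS' U (Finset.union_subset_right hU)]
      neg_mem' := by
        rintro a ⟨S, hS⟩
        exact ⟨S, fun U hU => by rw [map_neg, hS U hU]⟩ }
  let π : (∐ G).obj Y ⟶ AddCommGrpCat.of ((∐ G).obj Y ⧸ K) :=
    AddCommGrpCat.ofHom (QuotientAddGroup.mk' K)
  have hπ : π = 0 := by
    refine (isColimitOfPreserves ((evaluation _ _).obj Y)
      (colimit.isColimit (Discrete.functor G))).hom_ext ?_
    rintro ⟨i⟩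
    ext x
    refine (QuotientAddGroup.eq_zero_iff _).2 ?_
    refine ⟨{i}, fun S hS => ?_⟩
    have h : Sigma.ι G i ≫ truncation G S = Sigma.ι G i := by
      simp [truncation, Finset.singleton_subset_iff.1 hS]
    exact ConcreteCategory.congr_hom (NatTrans.congr_app h Y) x
  exact (QuotientAddGroup.eq_zero_iff _).1 (ConcreteCategory.congr_hom hπ z)

/-- A morphism from a representable functor to a direct sum of representable functors factors
through a representable direct summand. -/
lemma IsDirectSumOfRepresentables.exists_retract [HasFiniteBiproducts C]
    {F : Cᵒᵖ ⥤ AddCommGrpCat.{v}} (hF : IsDirectSumOfRepresentables F) {Y : C}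
    (φ : preadditiveYoneda.obj Y ⟶ F) :
    ∃ (X : C) (i : preadditiveYoneda.obj X ⟶ F) (p : F ⟶ preadditiveYoneda.obj X),
      i ≫ p = 𝟙 _ ∧ φ ≫ p ≫ i = φ := by
  classical
  obtain ⟨ι, A, ⟨e⟩⟩ := hF
  let G : ι → Cᵒᵖ ⥤ AddCommGrpCat.{v} := fun i => preadditiveYoneda.obj (A i)
  -- By Yoneda the morphism is a single element, supported on a finite `S`; the finite partial sum
  -- over `S` is represented by the biproduct.
  obtain ⟨S, hS⟩ := truncation_eventually_eq G (op Y) ((φ ≫ e.hom).app (op Y) (𝟙 Y))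
  let B : S → C := fun j => A j
  let i : preadditiveYoneda.obj (⨁ B) ⟶ ∐ G :=
    ∑ j : S, preadditiveYoneda.map (biproduct.π B j) ≫ Sigma.ι G j
  let p : ∐ G ⟶ preadditiveYoneda.obj (⨁ B) :=
    Sigma.desc fun k => if h : k ∈ S then preadditiveYoneda.map (biproduct.ι B ⟨k, h⟩) else 0
  have hp : ∀ j : S, Sigma.ι G j ≫ p = preadditiveYoneda.map (biproduct.ι B j) := by
    intro j
    simp [p]
  have hip : i ≫ p = 𝟙 _ := by
    simp only [i, Preadditive.sum_comp, Category.assoc, hp]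
    simp only [← Functor.map_comp, ← Functor.map_sum]
    have hB : ∑ j : S, biproduct.π B j ≫ biproduct.ι B j = 𝟙 (⨁ B) := by
      refine biproduct.hom_ext _ _ fun k => ?_
      simp [Preadditive.sum_comp, biproduct.ι_π, comp_dite]
    exact (congrArg preadditiveYoneda.map hB).trans (CategoryTheory.Functor.map_id _ _)
  have hpi : p ≫ i = truncation G S := by
    refine Sigma.hom_ext _ _ fun k => ?_
    by_cases hk : k ∈ S
    · rw [← Category.assoc, hp ⟨k, hk⟩]
      simp only [i, Preadditive.comp_sum, truncation, Sigma.ι_desc, hk, if_true]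
      rw [Finset.sum_eq_single ⟨k, hk⟩]
      · rw [← Category.assoc, ← Functor.map_comp]
        simp only [biproduct.ι_π_self]
        exact (congrArg (· ≫ _) (preadditiveYoneda.map_id (A k))).trans (Category.id_comp _)
      · intro j _ hj
        rw [← Category.assoc, ← Functor.map_comp, biproduct.ι_π_ne _ hj.symm, Functor.map_zero, zero_comp]
      · simp
    · simp [p, truncation, hk]
  refine ⟨⨁ B, i ≫ e.inv, e.hom ≫ p, by simpa using hip, ?_⟩
  have h : (φ ≫ e.hom) ≫ truncation G S = φ ≫ e.hom := natTrans_ext (hS S subset_rfl)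
  rw [← hpi] at h
  have := congr($h ≫ e.inv)
  simpa using this

end Compactness

/-! ### Bass' argument and Fitting's lemma -/

section Sequences

variable {C : Type u} [Category.{v} C] [HasZeroObject C] [HasShift C ℤ] [Preadditive C]
  [∀ n : ℤ, (shiftFunctor C n).Additive] [Pretriangulated C]

open scoped Pretriangulated.Opposite

instance : PreservesFilteredColimitsOfSize.{0, 0} (forget AddCommGrpCat.{v}) :=
  preservesFilteredColimitsOfSize_shrink _

/-- Sequential colimits of abelian groups are exact: an element and its vanishing are both witnessed
at a finite stage. -/
lemma isHomological_of_isColimit {K : ℕ ⥤ Cᵒᵖ ⥤ AddCommGrpCat.{v}}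
    (hK : ∀ n, (K.obj n).IsHomological) {c : Cocone K} (hc : IsColimit c) :
    c.pt.IsHomological := by
  have hW (W : Cᵒᵖ) := isColimitOfPreserves ((evaluation _ _).obj W) hc
  have hrep (W : Cᵒᵖ) (x : c.pt.obj W) : ∃ n, ∃ y : (K.obj n).obj W, (c.ι.app n).app W y = x :=
    Concrete.isColimit_exists_rep _ (hW W) x
  have hnat {W W' : Cᵒᵖ} (f : W ⟶ W') (n : ℕ) (y : (K.obj n).obj W) :
      c.pt.map f ((c.ι.app n).app W y) = (c.ι.app n).app W' ((K.obj n).map f y) :=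
    (ConcreteCategory.congr_hom ((c.ι.app n).naturality f) y).symm
  have hzero : c.pt.PreservesZeroMorphisms := ⟨fun W W' => by
    ext x
    obtain ⟨n, y, rfl⟩ := hrep W x
    have := hK n
    exact (hnat 0 n y).trans (by rw [Functor.map_zero]; exact map_zero _)⟩
  refine { exact := fun T hT => ?_ }
  rw [ShortComplex.ab_exact_iff]
  intro x hx
  obtain ⟨n, y, rfl⟩ := hrep T.obj₂ x
  have hy : (c.ι.app n).app T.obj₃ ((K.obj n).map T.mor₂ y) = (c.ι.app n).app T.obj₃ 0 :=
    (hnat T.mor₂ n y).symm.trans (hx.trans (map_zero _).symm)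
  obtain ⟨m, f, g, h⟩ := Concrete.isColimit_exists_of_rep_eq _ (hW T.obj₃) _ _ hy
  have h' : (K.obj m).map T.mor₂ ((K.map f).app T.obj₂ y) = 0 :=
    (ConcreteCategory.congr_hom ((K.map f).naturality T.mor₂) y).symm.trans
      (h.trans (map_zero _))
  have := hK m
  obtain ⟨z, hz⟩ := (ShortComplex.ab_exact_iff _).1 ((K.obj m).map_distinguished_exact T hT) _ h'
  refine ⟨(c.ι.app m).app T.obj₁ z, (hnat T.mor₁ m z).trans ?_⟩
  refine (congrArg ((c.ι.app m).app T.obj₂) hz).trans ?_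
  exact ConcreteCategory.congr_hom (NatTrans.congr_app (c.w f) T.obj₂) y

/-- In a locally noetherian triangulated category, a sequence of morphisms stabilises to a direct
summand of one of its terms: this is Bass' argument for perfect rings. -/
lemma LocallyNoetherian.exists_cocone (hC : LocallyNoetherian C) (G : ℕ ⥤ C) :
    ∃ (c : Cocone G) (N : ℕ) (s : c.pt ⟶ G.obj N), s ≫ c.ι.app N = 𝟙 _ ∧
      c.ι.app 0 ≫ s = G.map (homOfLE (Nat.zero_le N)) := by
  let K : ℕ ⥤ Cᵒᵖ ⥤ AddCommGrpCat.{v} := G ⋙ preadditiveYoneda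
  let d : Cocone K := colimit.cocone K
  have hd : IsColimit d := colimit.isColimit K
  have hF : d.pt.IsHomological :=
    isHomological_of_isColimit (fun n => inferInstanceAs (preadditiveYoneda.obj _).IsHomological) hd
  have hW (W : Cᵒᵖ) := isColimitOfPreserves ((evaluation _ _).obj W) hd
  obtain ⟨Y, i, p, hip, hpi⟩ := (hC d.pt hF).exists_retract (d.ι.app 0)
  let q : ∀ n, G.obj n ⟶ Y := fun n => preadditiveYoneda.preimage (d.ι.app n ≫ p)
  have hq (n) : preadditiveYoneda.map (q n) = d.ι.app n ≫ p := Functor.map_preimage _ _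
  have hqw {m n : ℕ} (f : m ⟶ n) : G.map f ≫ q n = q m := by
    apply preadditiveYoneda.map_injective
    rw [Functor.map_comp, hq, hq, ← d.w f]
    rfl
  -- The inclusion of `Y` is an element of the colimit at `Y`, so it lifts to a finite stage.
  obtain ⟨N₀, s₀, hs₀⟩ : ∃ n, ∃ s : Y ⟶ G.obj n, (d.ι.app n).app (op Y) s = i.app (op Y) (𝟙 Y) :=
    Concrete.isColimit_exists_rep _ (hW (op Y)) _
  have hi : preadditiveYoneda.map s₀ ≫ d.ι.app N₀ = i := by
    refine natTrans_ext (Eq.trans ?_ hs₀)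
    exact congrArg ((d.ι.app N₀).app (op Y)) (Category.id_comp s₀)
  have h₀ : (d.ι.app N₀).app (op (G.obj 0)) (q 0 ≫ s₀) =
      (d.ι.app 0).app (op (G.obj 0)) (𝟙 (G.obj 0)) := by
    have h : preadditiveYoneda.map (q 0 ≫ s₀) ≫ d.ι.app N₀ = d.ι.app 0 := by
      rw [Functor.map_comp, Category.assoc, hi, hq, Category.assoc, hpi]
    refine Eq.trans ?_ (ConcreteCategory.congr_hom (NatTrans.congr_app h (op (G.obj 0))) (𝟙 (G.obj 0)))
    exact congrArg ((d.ι.app N₀).app (op (G.obj 0))) (Category.id_comp (q 0 ≫ s₀)).symm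
  -- The two elements agree only in the colimit; passing to a later stage `N` makes them equal.
  obtain ⟨N, f, g, hN⟩ := Concrete.isColimit_exists_of_rep_eq _ (hW (op (G.obj 0))) _ _ h₀
  have hN' : (q 0 ≫ s₀) ≫ G.map f = 𝟙 _ ≫ G.map g := hN
  refine ⟨⟨Y, { app := q, naturality := fun _ _ f => by simpa using hqw f }⟩, N, s₀ ≫ G.map f,
    ?_, ?_⟩
  · change (s₀ ≫ G.map f) ≫ q N = 𝟙 _
    rw [Category.assoc, hqw]
    apply preadditiveYoneda.map_injective
    rw [Functor.map_comp, hq, reassoc_of% hi, hip, CategoryTheory.Functor.map_id]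
  · change q 0 ≫ s₀ ≫ G.map f = _
    rw [← Category.assoc, hN', Category.id_comp]
    rfl

/-- Every sequence of epimorphisms has a term which is a split monomorphism. -/
lemma LocallyNoetherian.exists_isSplitMono (hC : LocallyNoetherian C) (G : ℕ ⥤ C)
    (hG : ∀ n, Epi (G.map (homOfLE (Nat.le_add_right n 1)))) :
    ∃ n, IsSplitMono (G.map (homOfLE (Nat.le_add_right n 1))) := by
  obtain ⟨c, N, s, -, h⟩ := hC.exists_cocone G
  have hepi : ∀ n, Epi (G.map (homOfLE (Nat.zero_le n))) := by
    intro n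
    induction n with
    | zero => exact inferInstanceAs (Epi (G.map (𝟙 0)))
    | succ n hn =>
      rw [← homOfLE_comp (Nat.zero_le n) (Nat.le_add_right n 1), Functor.map_comp]
      have := hG n
      exact epi_comp _ _
  have := hepi N
  have hN : c.ι.app N ≫ s = 𝟙 _ := by
    rw [← cancel_epi (G.map (homOfLE (Nat.zero_le N))), ← Category.assoc,
      c.w, h, Category.comp_id]
  exact ⟨N, IsSplitMono.mk' ⟨c.ι.app (N + 1) ≫ s, by rw [← Category.assoc, c.w, hN]⟩⟩

/-- A nonzero object whose retracts are trivial. In a triangulated category, this holds if and only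
if the object is indecomposable. -/
def HasTrivialRetracts {D : Type*} [Category D] (X : D) : Prop :=
  ¬ IsZero X ∧ ∀ ⦃Y : D⦄ (r : Retract Y X), IsZero Y ∨ IsIso r.i

/-- The cone of the split mono `r.i` is a complementary summand, so it or the retract vanishes. The
retract form is the one that dualises directly. -/
lemma hasTrivialRetracts_of_indecomposable {X : C} (hX : Indecomposable X) :
    HasTrivialRetracts X := by
  refine ⟨hX.1, fun Y r => ?_⟩
  obtain ⟨Z, g, h, hT⟩ := distinguished_cocone_triangle r.i
  have hh : h = 0 := Triangle.mor₃_eq_zero_of_mono₁ _ hT (inferInstanceAs (Mono r.i))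
  obtain ⟨e, -⟩ := exists_iso_binaryBiproduct_of_distTriang _ hT hh
  refine (hX.2 _ _ e).imp_right fun hZ => ?_
  exact (Triangle.isZero₃_iff_isIso₁ _ hT).1 hZ

lemma HasTrivialRetracts.op {D : Type*} [Category D] [HasZeroMorphisms D] {X : D}
    (hX : HasTrivialRetracts X) : HasTrivialRetracts (op X) := by
  refine ⟨fun h => hX.1 h.unop, fun Y r => ?_⟩
  let r' : Retract Y.unop X := ⟨r.r.unop, r.i.unop, by rw [← unop_comp, r.retract, unop_id]⟩
  rcases hX.2 r' with h | h
  · exact Or.inl h.op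
  · right
    have h' : IsIso r.r.unop := h
    have : IsIso r.r := (isIso_unop_iff _).1 h'
    exact ⟨r.r, r.retract, by
      rw [← cancel_mono r.r, Category.assoc, r.retract, Category.comp_id, Category.id_comp]⟩

/-- Fitting's lemma. -/
lemma LocallyNoetherian.isNilpotent_or_isIso (hC : LocallyNoetherian C) {X : C}
    (hX : HasTrivialRetracts X) (f : End X) : IsNilpotent f ∨ IsIso (f : X ⟶ X) := by
  let G : ℕ ⥤ C := Functor.ofSequence (X := fun _ => X) fun _ => f
  have hG (n : ℕ) : G.map (homOfLE (Nat.zero_le n)) = (f ^ n : End X) := by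
    induction n with
    | zero => exact G.map_id 0
    | succ n hn =>
      have : G.map (homOfLE (Nat.zero_le (n + 1))) =
          G.map (homOfLE (Nat.zero_le n)) ≫ G.map (homOfLE (Nat.le_add_right n 1)) := by
        rw [← Functor.map_comp]; rfl
      rw [this, hn, Functor.ofSequence_map_homOfLE_succ, pow_succ']
      rfl
  obtain ⟨c, N, s, h₁, h₂⟩ := hC.exists_cocone G
  -- If the summand is zero then `f ^ N` factors through zero; if it is all of `X` then `f` is a
  -- split mono, hence itself a retract inclusion.
  rcases hX.2 (⟨s, c.ι.app N, h₁⟩ : Retract c.pt X) with h | h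
  · refine Or.inl ⟨N, ?_⟩
    rw [← hG, ← h₂]
    exact (congrArg (· ≫ s) (h.eq_of_tgt _ 0)).trans zero_comp
  · right
    have hs : IsIso s := h
    have hN : c.ι.app N ≫ s = 𝟙 _ := by
      rw [← cancel_epi s, reassoc_of% h₁, Category.comp_id]
    have hw : (f : X ⟶ X) ≫ c.ι.app (N + 1) = c.ι.app N := by
      have := c.w (homOfLE (Nat.le_add_right N 1))
      rwa [Functor.ofSequence_map_homOfLE_succ] at this
    let r : Retract X X := ⟨f, c.ι.app (N + 1) ≫ s,
      (Category.assoc _ _ _).symm.trans ((congrArg (· ≫ s) hw).trans hN)⟩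
    exact (hX.2 r).resolve_left hX.1

end Sequences

/-! ### Construction of Auslander–Reiten triangles -/

section Existence

variable {C : Type u} [Category.{v} C] [HasZeroObject C] [HasShift C ℤ] [Preadditive C]
  [∀ n : ℤ, (shiftFunctor C n).Additive] [Pretriangulated C]

open scoped Pretriangulated.Opposite

omit [HasZeroObject C] [HasShift C ℤ] [∀ n : ℤ, (shiftFunctor C n).Additive]
  [Pretriangulated C] in
lemma not_isIso_biprod_fst [HasBinaryBiproducts C] {A B : C} (hB : ¬ IsZero B) :
    ¬ IsIso (biprod.fst : A ⊞ B ⟶ A) := by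
  intro h
  apply hB
  rw [IsZero.iff_id_eq_zero, ← biprod.inr_snd (X := A),
    (cancel_mono (biprod.fst : A ⊞ B ⟶ A)).1 (biprod.inr_fst.trans zero_comp.symm), zero_comp]

omit [HasZeroObject C] [HasShift C ℤ] [∀ n : ℤ, (shiftFunctor C n).Additive]
  [Pretriangulated C] in
lemma not_isIso_biprod_snd [HasBinaryBiproducts C] {A B : C} (hA : ¬ IsZero A) :
    ¬ IsIso (biprod.snd : A ⊞ B ⟶ B) := by
  intro h
  apply hA
  rw [IsZero.iff_id_eq_zero, ← biprod.inl_fst (Y := B),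
    (cancel_mono (biprod.snd : A ⊞ B ⟶ B)).1 (biprod.inl_snd.trans zero_comp.symm), zero_comp]

lemma exists_retract_of_not_indecomposable {Z X : C} {γ : Z ⟶ X} (hγ : γ ≠ 0)
    (hX : ¬ Indecomposable X) :
    ∃ (A : C) (r : Retract A X), γ ≫ r.r ≠ 0 ∧ ¬ IsIso r.r := by
  have hX' : ¬ IsZero X := fun h => hγ (h.eq_of_tgt _ _)
  simp only [Indecomposable, not_and, not_forall, not_or] at hX
  obtain ⟨A, B, e, hA, hB⟩ := hX hX'
  by_cases h : γ ≫ e.hom ≫ biprod.fst = 0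
  · refine ⟨B, ⟨biprod.inr ≫ e.inv, e.hom ≫ biprod.snd, by simp⟩, fun h' => hγ ?_, fun h' => ?_⟩
    · rw [← cancel_mono e.hom]
      ext <;> simpa
    · have h' : IsIso (e.hom ≫ (biprod.snd : A ⊞ B ⟶ B)) := h'
      exact not_isIso_biprod_snd hA (IsIso.of_isIso_comp_left e.hom _)
  · refine ⟨A, ⟨biprod.inl ≫ e.inv, e.hom ≫ biprod.fst, by simp⟩, h, fun h' => ?_⟩
    have h' : IsIso (e.hom ≫ (biprod.fst : A ⊞ B ⟶ A)) := h'
    exact not_isIso_biprod_fst hB (IsIso.of_isIso_comp_left e.hom _)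

/-- In a locally noetherian triangulated category, a nonzero morphism has a nonzero component in
some indecomposable direct summand of its target. -/
lemma LocallyNoetherian.exists_indecomposable_retract (hC : LocallyNoetherian C) {Z X : C}
    {γ : Z ⟶ X} (hγ : γ ≠ 0) :
    ∃ (A : C) (r : Retract A X), Indecomposable A ∧ γ ≫ r.r ≠ 0 := by
  by_contra! hcon
  -- Otherwise proper summands with nonzero component can be split off forever, an infinite chain of
  -- non-invertible split epis.
  let σ := {p : Σ A : C, Retract A X // γ ≫ p.2.r ≠ 0}
  have hstep (p : σ) : ∃ (p' : σ) (q : p.1.1 ⟶ p'.1.1), IsSplitEpi q ∧ ¬ IsIso q := by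
    obtain ⟨A, r, h₁, h₂⟩ := exists_retract_of_not_indecomposable p.2
      (fun h => p.2 (hcon p.1.1 p.1.2 h))
    exact ⟨⟨⟨A, r.trans p.1.2⟩, by simpa using h₁⟩, r.r, ⟨⟨⟨r.i, r.retract⟩⟩⟩, h₂⟩
  choose next q hq hq' using hstep
  let s : ℕ → σ := fun n => next^[n] ⟨⟨X, Retract.refl X⟩, by simpa using hγ⟩
  have hs (n : ℕ) : s (n + 1) = next (s n) := Function.iterate_succ_apply' _ _ _
  let f (n : ℕ) : (s n).1.1 ⟶ (s (n + 1)).1.1 := q (s n) ≫ eqToHom (by rw [hs n])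
  have hf (n : ℕ) : Epi (f n) := by
    have := hq (s n)
    exact epi_comp (q (s n)) _
  obtain ⟨n, hn⟩ := hC.exists_isSplitMono (Functor.ofSequence f) (fun n => by
    rw [Functor.ofSequence_map_homOfLE_succ]
    exact hf n)
  rw [Functor.ofSequence_map_homOfLE_succ] at hn
  have : Mono (q (s n)) := @mono_of_mono _ _ _ _ _ (q (s n)) _ (@IsSplitMono.mono _ _ _ _ (f n) hn)
  have := hq (s n)
  exact hq' (s n) (isIso_of_mono_of_isSplitEpi _)

/-- The additive group of non-isomorphisms of an object with local endomorphism ring. -/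
def nonIsos (hC : LocallyNoetherian C) {Z : C} (hZ : HasTrivialRetracts Z) :
    AddSubgroup (Z ⟶ Z) where
  carrier := {g | ¬ IsIso g}
  zero_mem' h := hZ.1 (by
    have h : IsIso (0 : Z ⟶ Z) := h
    rw [IsZero.iff_id_eq_zero, ← IsIso.hom_inv_id (0 : Z ⟶ Z), zero_comp])
  add_mem' {a b} ha hb h := by
    have h : IsIso (a + b) := h
    have hab : b ≫ inv (a + b) = 𝟙 Z - a ≫ inv (a + b) := by
      rw [eq_sub_iff_add_eq', ← Preadditive.add_comp, IsIso.hom_inv_id]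
    rcases hC.isNilpotent_or_isIso hZ (a ≫ inv (a + b)) with h' | h'
    · have := (isUnit_iff_isIso _).1 h'.isUnit_one_sub
      have h₂ : IsIso (b ≫ inv (a + b)) := by rw [hab]; exact this
      exact hb (IsIso.of_isIso_comp_right b (inv (a + b)))
    · exact ha (IsIso.of_isIso_comp_right a (inv (a + b)))
  neg_mem' {a} ha h := ha (by
    have h : IsIso (-a) := h
    exact ⟨-inv (-a), by rw [Preadditive.comp_neg, ← Preadditive.neg_comp, IsIso.hom_inv_id],
      by rw [Preadditive.neg_comp, ← Preadditive.comp_neg, IsIso.inv_hom_id]⟩)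

/-- The functor sending `W` to the `J`-dual of `Hom(Z, W)`. -/
abbrev dualHom (Z : C) (J : AddCommGrpCat.{v}) : Cᵒᵖ ⥤ AddCommGrpCat.{v} :=
  (preadditiveCoyoneda.obj (op Z)).op ⋙ preadditiveYoneda.obj J

lemma isHomological_dualHom (Z : C) (J : AddCommGrpCat.{v}) [Injective J] :
    (dualHom Z J).IsHomological where
  exact T hT := by
    rw [ShortComplex.ab_exact_iff]
    intro φ hφ
    have hS := (preadditiveCoyoneda.obj (op Z)).map_distinguished_exact _ (unop_distinguished T hT)
    exact ⟨hS.descToInjective φ hφ, hS.comp_descToInjective φ hφ⟩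

-- Since `δ ≠ 0`, everything in the kernel of `Hom(Z, δ)` is a non-isomorphism, so `x` vanishes
-- there and extends by injectivity of `J`.
omit [HasZeroObject C] [HasShift C ℤ] [∀ n : ℤ, (shiftFunctor C n).Additive]
  [Pretriangulated C] in
lemma exists_extension {Z : C} {J : AddCommGrpCat.{v}} [Injective J]
    (x : (preadditiveCoyoneda.obj (op Z)).obj Z ⟶ J) (hx : ∀ g : Z ⟶ Z, ¬ IsIso g → x g = 0)
    {W : C} {δ : Z ⟶ W} (hδ : δ ≠ 0) :
    ∃ χ : (preadditiveCoyoneda.obj (op Z)).obj W ⟶ J,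
      (preadditiveCoyoneda.obj (op Z)).map δ ≫ χ = x := by
  let φ := (preadditiveCoyoneda.obj (op Z)).map δ
  have hS : (ShortComplex.mk (kernel.ι φ) φ (kernel.condition φ)).Exact :=
    ShortComplex.exact_of_f_is_kernel _ (kernelIsKernel φ)
  have h0 : kernel.ι φ ≫ x = 0 := by
    ext k
    refine hx (kernel.ι φ k) fun hk => hδ ?_
    have h : (kernel.ι φ k : Z ⟶ Z) ≫ δ = 0 := ConcreteCategory.congr_hom (kernel.condition φ) k
    exact (@cancel_epi _ _ _ _ _ (kernel.ι φ k : Z ⟶ Z) (@IsIso.epi_of_iso _ _ _ _ _ hk) _ _).1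
      (h.trans comp_zero.symm)
  exact ⟨hS.descToInjective x h0, hS.comp_descToInjective x h0⟩

/-- The connecting morphism of an Auslander–Reiten triangle determines the triangle. -/
lemma existsARTriangleEndingAt_of_hom {Z X : C} (γ : Z ⟶ X) (hγ : γ ≠ 0)
    (h₁ : ∀ ⦃W : C⦄ (g : W ⟶ Z), ¬ IsSplitEpi g → g ≫ γ = 0)
    (h₂ : ∀ ⦃W : C⦄ (f : X ⟶ W), ¬ IsSplitMono f → γ ≫ f = 0) :
    ExistsARTriangleEndingAt Z := by
  let A : C := X⟦(-1 : ℤ)⟧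
  let e : A⟦(1 : ℤ)⟧ ≅ X := (shiftFunctorCompIsoId C (-1 : ℤ) 1 (by simp)).app X
  let γ' : Z ⟶ A⟦(1 : ℤ)⟧ := γ ≫ e.inv
  have hγ' : γ' ≠ 0 := fun h => hγ (by
    rw [← cancel_mono e.inv, zero_comp]; exact h)
  obtain ⟨Y, α, β, hT⟩ := distinguished_cocone_triangle₂ γ'
  refine ⟨A, Y, α, β, γ', hT, ⟨fun h => hγ' ?_, fun W (φ : A ⟶ W) hφ => ?_⟩, ⟨fun h => hγ' ?_,
    fun W (g : W ⟶ Z) hg => ?_⟩⟩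
  · have h : IsSplitMono α := h
    exact Triangle.mor₃_eq_zero_of_mono₁ _ hT (inferInstanceAs (Mono α))
  · have hφ' : ¬ IsSplitMono (e.inv ≫ φ⟦(1 : ℤ)⟧') := fun h => hφ (by
      have h1 : IsSplitMono (φ⟦(1 : ℤ)⟧') :=
        ⟨⟨⟨retraction (e.inv ≫ φ⟦(1 : ℤ)⟧') ≫ e.inv, by
          rw [← cancel_epi e.inv, ← cancel_mono e.hom]
          have := IsSplitMono.id (e.inv ≫ φ⟦(1 : ℤ)⟧')
          rw [Category.assoc] at this
          simpa⟩⟩⟩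
      exact (Functor.isSplitMono_iff (shiftFunctor C (1 : ℤ)) φ).1 h1)
    have h0 : γ' ≫ φ⟦(1 : ℤ)⟧' = 0 := by
      rw [Category.assoc]; exact h₂ _ hφ'
    obtain ⟨g, hg⟩ := Triangle.yoneda_exact₂ _
      (rot_of_distTriang _ (rot_of_distTriang _ hT)) (φ⟦(1 : ℤ)⟧') h0
    obtain ⟨(g' : Y ⟶ W), rfl⟩ := (shiftFunctor C (1 : ℤ)).map_surjective g
    -- Rotating twice turns `α⟦1⟧'` into its negative.
    refine ⟨-g', (shiftFunctor C (1 : ℤ)).map_injective ?_⟩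
    rw [hg]
    change (shiftFunctor C (1 : ℤ)).map (α ≫ (-g')) =
      (-(shiftFunctor C (1 : ℤ)).map α) ≫ (shiftFunctor C (1 : ℤ)).map g'
    rw [Functor.map_comp, Functor.map_neg, Preadditive.comp_neg, Preadditive.neg_comp]
  · have h : IsSplitEpi β := h
    exact Triangle.mor₃_eq_zero_of_epi₂ _ hT (inferInstanceAs (Epi β))
  · obtain ⟨k, hk⟩ := Triangle.coyoneda_exact₃ _ hT g
      (by change g ≫ γ ≫ e.inv = 0; rw [← Category.assoc, h₁ g hg, zero_comp])
    exact ⟨k, hk.symm⟩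

lemma LocallyNoetherian.existsARTriangleEndingAt (hC : LocallyNoetherian C) {Z : C}
    (hZ : HasTrivialRetracts Z) : ExistsARTriangleEndingAt Z := by
  let Q : AddCommGrpCat.{v} := AddCommGrpCat.of ((Z ⟶ Z) ⧸ nonIsos hC hZ)
  let J : AddCommGrpCat.{v} := Injective.under Q
  let x : (preadditiveCoyoneda.obj (op Z)).obj Z ⟶ J :=
    AddCommGrpCat.ofHom (QuotientAddGroup.mk' (nonIsos hC hZ)) ≫ Injective.ι Q
  have hx (g : Z ⟶ Z) (hg : ¬ IsIso g) : x g = 0 :=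
    (congrArg (Injective.ι Q) ((QuotientAddGroup.eq_zero_iff (N := nonIsos hC hZ) g).2 hg)).trans
      (map_zero _)
  have hx1 : x (𝟙 Z) ≠ 0 := fun h => by
    have := (AddCommGrpCat.mono_iff_injective _).1 (Injective.ι_mono Q)
    have h' := this (h.trans (map_zero (Injective.ι Q).hom).symm)
    exact (QuotientAddGroup.eq_zero_iff (N := nonIsos hC hZ) (𝟙 Z)).1 h' inferInstance
  let F := dualHom Z J
  have hF : F.IsHomological := isHomological_dualHom Z J
  let ξ : preadditiveYoneda.obj Z ⟶ F := yonedaLift F (X := Z) x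
  obtain ⟨X, i, p, -, hξ⟩ := (hC F hF).exists_retract ξ
  let γ : Z ⟶ X := preadditiveYoneda.preimage (ξ ≫ p)
  have hγξ : preadditiveYoneda.map γ = ξ ≫ p := Functor.map_preimage _ _
  have hlift {V W : C} (g : V ⟶ W) (y : F.obj (op W)) :
      (preadditiveYoneda.map g ≫ yonedaLift F y).app (op V) (𝟙 V) = F.map g.op y :=
    congrArg (fun h : V ⟶ W => F.map h.op y) (Category.id_comp g)
  have hγ : γ ≠ 0 := fun h => hx1 (by
    have hξ0 : ξ = 0 := by
      rw [← hξ, ← Category.assoc, ← hγξ, h, Functor.map_zero, zero_comp]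
    have h1 : F.map (𝟙 Z).op x = 0 := by
      refine Eq.trans (b := ξ.app (op Z) (𝟙 Z)) rfl ?_
      rw [hξ0]; rfl
    have h2 : (x : F.obj (op Z)) = 0 := by
      rwa [op_id, CategoryTheory.Functor.map_id] at h1
    exact ConcreteCategory.congr_hom h2 (𝟙 Z))
  have hγ₁ {W : C} (g : W ⟶ Z) (hg : ¬ IsSplitEpi g) : g ≫ γ = 0 := by
    apply preadditiveYoneda.map_injective
    have h0 : preadditiveYoneda.map g ≫ ξ = 0 := by
      refine natTrans_ext ((hlift g x).trans ?_)
      change (preadditiveCoyoneda.obj (op Z)).map g ≫ x = 0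
      ext (h : Z ⟶ W)
      refine hx (h ≫ g) fun hh => hg ⟨⟨⟨inv (h ≫ g) ≫ h, by simp⟩⟩⟩
    rw [Functor.map_comp, hγξ, reassoc_of% h0, zero_comp, Functor.map_zero]
  obtain ⟨A, r, hA, hγr⟩ := hC.exists_indecomposable_retract hγ
  refine existsARTriangleEndingAt_of_hom (γ ≫ r.r) hγr
    (fun W g hg => by rw [← Category.assoc, hγ₁ g hg, zero_comp]) fun W f => ?_
  contrapose!
  -- With `γ' = γ ≫ r.r`, extending `x` along `γ' ≫ f` produces `w` with `γ' ≫ f ≫ w = γ'`.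
  intro hf
  obtain ⟨χ, hχ⟩ := exists_extension x hx hf
  obtain ⟨η, hη⟩ : ∃ η : preadditiveYoneda.obj W ⟶ F,
      preadditiveYoneda.map ((γ ≫ r.r) ≫ f) ≫ η = ξ := by
    refine ⟨yonedaLift F (X := W) χ, natTrans_ext ((hlift _ _).trans ?_)⟩
    refine Eq.trans (b := F.map (𝟙 Z).op x) ?_ rfl
    rw [op_id, CategoryTheory.Functor.map_id]
    exact hχ
  let w : W ⟶ A := preadditiveYoneda.preimage (η ≫ p ≫ preadditiveYoneda.map r.r)
  have hw : (γ ≫ r.r) ≫ f ≫ w = γ ≫ r.r := by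
    apply preadditiveYoneda.map_injective
    rw [← Category.assoc, Functor.map_comp, Functor.map_preimage, ← Category.assoc, hη,
      Functor.map_comp, hγξ, Category.assoc]
  rcases hC.isNilpotent_or_isIso (hasTrivialRetracts_of_indecomposable hA) (f ≫ w) with h | h
  -- A nilpotent `f ≫ w` fixing `γ'` would force `γ' = 0`.
  · obtain ⟨n, hn⟩ := h
    let u : End A := f ≫ w
    have hpow (m : ℕ) : (γ ≫ r.r) ≫ (u ^ m : End A) = γ ≫ r.r := by
      induction m with
      | zero => exact Category.comp_id _
      | succ m hm =>
        rw [pow_succ]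
        change (γ ≫ r.r) ≫ (f ≫ w) ≫ (u ^ m : End A) = _
        rw [← Category.assoc, hw, hm]
    exact absurd ((hpow n).symm.trans ((congrArg ((γ ≫ r.r) ≫ ·) hn).trans comp_zero)) hγr
  · have h : IsIso (f ≫ w) := h
    exact ⟨⟨⟨w ≫ inv (f ≫ w), by rw [← Category.assoc, IsIso.hom_inv_id]⟩⟩⟩

omit [HasZeroObject C] [HasShift C ℤ] [Preadditive C] [∀ n : ℤ, (shiftFunctor C n).Additive]
  [Pretriangulated C] in
lemma IsRightAlmostSplit.unop {X Y : Cᵒᵖ} {f : X ⟶ Y} (hf : IsRightAlmostSplit f) :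
    IsLeftAlmostSplit f.unop := by
  refine ⟨fun h => hf.1 ⟨⟨⟨(retraction f.unop).op, ?_⟩⟩⟩, fun W g hg => ?_⟩
  · exact Quiver.Hom.unop_inj (IsSplitMono.id f.unop)
  · obtain ⟨h, hh⟩ := hf.2 g.op fun h' =>
      hg ⟨⟨⟨(section_ g.op).unop, Quiver.Hom.op_inj (IsSplitEpi.id g.op)⟩⟩⟩
    exact ⟨h.unop, Quiver.Hom.op_inj hh⟩

omit [HasZeroObject C] [HasShift C ℤ] [Preadditive C] [∀ n : ℤ, (shiftFunctor C n).Additive]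
  [Pretriangulated C] in
lemma IsLeftAlmostSplit.unop {X Y : Cᵒᵖ} {f : X ⟶ Y} (hf : IsLeftAlmostSplit f) :
    IsRightAlmostSplit f.unop := by
  refine ⟨fun h => hf.1 ⟨⟨⟨(section_ f.unop).op, ?_⟩⟩⟩, fun W g hg => ?_⟩
  · exact Quiver.Hom.unop_inj (IsSplitEpi.id f.unop)
  · obtain ⟨h, hh⟩ := hf.2 g.op fun h' =>
      hg ⟨⟨⟨(retraction g.op).unop, Quiver.Hom.op_inj (IsSplitMono.id g.op)⟩⟩⟩
    exact ⟨h.unop, Quiver.Hom.op_inj hh⟩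

lemma ExistsARTriangleEndingAt.unop {X : C} (h : ExistsARTriangleEndingAt (op X)) :
    ExistsARTriangleStartingAt X := by
  obtain ⟨A, B, α, β, γ, hT, hα, hβ⟩ := h
  exact ⟨_, _, _, _, _, unop_distinguished _ hT, hβ.unop, hα.unop⟩

lemma LocallyFinite.existsARTriangleStartingAt (hC : LocallyFinite C) {X : C}
    (hX : HasTrivialRetracts X) : ExistsARTriangleStartingAt X :=
  (hC.2.existsARTriangleEndingAt hX.op).unop

end Existence

end ARTriangles

theorem proposition3p1 (T : Type u) [Category.{v} T] [HasZeroObject T] [HasShift T ℤ]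
    [Preadditive T] [∀ n : ℤ, (shiftFunctor T n).Additive] [Pretriangulated T]
    [IsTriangulated T] [EssentiallySmall.{v} T] :
    (ARTriangles.LocallyNoetherian T →
      ∀ Z : T, Indecomposable Z → ARTriangles.ExistsARTriangleEndingAt Z) ∧
    (ARTriangles.LocallyFinite T →
      ∀ X : T, Indecomposable X →
        ARTriangles.ExistsARTriangleStartingAt X ∧ ARTriangles.ExistsARTriangleEndingAt X) :=
  ⟨fun h _ hZ => h.existsARTriangleEndingAt (ARTriangles.hasTrivialRetracts_of_indecomposable hZ),
    fun h _ hX =>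
      have hX' := ARTriangles.hasTrivialRetracts_of_indecomposable hX
      ⟨h.existsARTriangleStartingAt hX', h.1.existsARTriangleEndingAt hX'⟩⟩
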